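/- For a positive integer $n$ let $\psi(n)=n\prod_{p\mid n}\left(1+\frac1p\right)$ (product over the distinct primes $p$ dividing $n$) be the Dedekind function. Two positive integers $a,b$ are called $\psi$-amicable if $\psi(a)=\psi(b)=a+b$, and a positive integer is called a $\psi$-amicable number if it belongs to such a pair. Let $M(n)$ denote the number of $\psi$-amicable pairs $(a,b)$ with $a<b$ and $a\le n$. Then $M(n)=o(n)$ as $n\to\infty$. Moreover, the set of $\psi$-amicable numbers has asymptotic density zero, that is, $$\lim_{n\to\infty}\frac{\#\{m\le n : m \text{ is a } \psi\text{-amicable number}\}}{n}=0 .$$ -/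

import Mathlib

open Filter Asymptotics Topology

/-- The Dedekind function `ψ(n) = n ∏_{p ∣ n} (1 + 1/p)`, as a natural number:
`n / ∏_{p ∣ n} p * ∏_{p ∣ n} (p + 1)` (the division is exact). -/
def dedekindPsi (n : ℕ) : ℕ :=
  n / (∏ p ∈ n.primeFactors, p) * ∏ p ∈ n.primeFactors, (p + 1)

/-- The defining product formula of the Dedekind function. -/
theorem dedekindPsi_eq (n : ℕ) :
    (dedekindPsi n : ℚ) = n * ∏ p ∈ n.primeFactors, (1 + 1 / (p : ℚ)) := by
  have hne : ∀ p ∈ n.primeFactors, (p : ℚ) ≠ 0 := fun p hp =>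
    Nat.cast_ne_zero.mpr (Nat.prime_of_mem_primeFactors hp).ne_zero
  have hprod : (∏ p ∈ n.primeFactors, (p : ℚ)) ≠ 0 := Finset.prod_ne_zero_iff.mpr hne
  have h : ∏ p ∈ n.primeFactors, (1 + 1 / (p : ℚ))
      = (∏ p ∈ n.primeFactors, ((p : ℚ) + 1)) / ∏ p ∈ n.primeFactors, (p : ℚ) := by
    rw [← Finset.prod_div_distrib]
    refine Finset.prod_congr rfl fun p hp => ?_
    have := hne p hp
    field_simp
  have hcast : ((∏ p ∈ n.primeFactors, p : ℕ) : ℚ) ≠ 0 := by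
    push_cast
    exact hprod
  rw [h, dedekindPsi, Nat.cast_mul, Nat.cast_div (Nat.prod_primeFactors_dvd n) hcast]
  push_cast
  ring

/-- Two positive integers `a`, `b` are `ψ`-amicable if `ψ(a) = ψ(b) = a + b`. -/
def PsiAmicable (a b : ℕ) : Prop :=
  0 < a ∧ 0 < b ∧ dedekindPsi a = a + b ∧ dedekindPsi b = a + b

/-- A `ψ`-amicable number: a member of some `ψ`-amicable pair. -/
def IsPsiAmicableNumber (m : ℕ) : Prop :=
  ∃ b : ℕ, PsiAmicable m b

/-- The `ψ`-amicable pairs `(a, b)` with `a < b` and `a ≤ n`. -/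
def psiAmicablePairs (n : ℕ) : Set (ℕ × ℕ) :=
  {x | PsiAmicable x.1 x.2 ∧ x.1 < x.2 ∧ x.1 ≤ n}

/-- There are finitely many such pairs, so that their `Set.ncard` is their true number. -/
theorem psiAmicablePairs_finite (n : ℕ) : (psiAmicablePairs n).Finite := by
  refine ((Finset.range (n + 1)).image fun a => (a, dedekindPsi a - a)).finite_toSet.subset ?_
  rintro ⟨a, b⟩ ⟨⟨_, _, h, _⟩, _, hn⟩
  simp only [Finset.coe_image, Set.mem_image, Finset.mem_coe, Finset.mem_range, Prod.mk.injEq]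
  simp only at h hn
  exact ⟨a, by omega, rfl, by omega⟩

/-- `M(n)`: the number of `ψ`-amicable pairs `(a, b)` with `a < b` and `a ≤ n`. -/
noncomputable def psiAmicableCount (n : ℕ) : ℕ :=
  (psiAmicablePairs n).ncard

/-!
Call `a` *smaller* if `ψ(a) = ψ(b) = a + b` for some `b ≥ a`. Every `ψ`-amicable number up to `n` is
either smaller or of the form `ψ(a) - a` with `a ≤ n` smaller, and a pair is determined by its
smaller member, so both claims follow once the smaller numbers have density zero
(`eventually_card_smaller_le`). The method is that of Erdős for classical amicable numbers.

Let `h_T(n) = ∏_{p ∣ n, p ≤ T} (1 + 1/p)` (`psiRatioUpTo`) and let `M` be the product of the primes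
`p ≤ T`.

* For almost all `a`, some prime `p ≡ -1 (mod M)` divides `a`, because the reciprocals of these
  primes have divergent sum (`not_summable_one_div_primes_modEq`). Then `M ∣ p + 1 ∣ ψ(a) = a + b`,
  so `a` and `b` have the same prime factors up to `T`, and `h_T(a) = h_T(b)`.
* If `a` is smaller, then `ψ(a)/a = 1 + b/a ≥ 2` while `h_T(a) = h_T(b) ≤ ψ(b)/b = 1 + a/b ≤ 2`. On
  average `∑_{p ∣ a, p > T} 1/p` is at most `1/T` (`sum_tailSum_le`), so apart from few `a` the ratio
  `ψ(a)/a` exceeds `h_T(a)` by a factor of at most `exp η`. Hence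
  `2 exp (-η) ≤ h_T(a) ≤ 2` (`PsiAmicable.psiRatioUpTo_mem`).
* The values of `h_T` do not concentrate in such a short interval
  (`count_psiRatioUpTo_mul_sum_le`). Let `E` be the set of `n` with `h_T(n)` in the interval. For
  `p ∤ n` one has `h_T(np) = h_T(n)(1 + 1/p)`, and the factors `1 + 1/p` with `p ≤ K` are separated,
  so if the interval is short compared with `1/K²`, the map `(n, p) ↦ np` is injective on the pairs
  with `n ∈ E`, `p ≤ K` and `p ∤ n`. Counting its values, and allowing `1/p²` for
  the `n` divisible by `p`, gives
  `density(E) · ∑_{p ≤ K} 1/p ≤ 1 + ∑_{p ≤ K} 1/p² ≤ 2`, and `∑ 1/p` diverges.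

The parameters are chosen in the order `K`, `η`, `T`.
-/

/-! ### Reciprocals of primes in a residue class -/

/-- The quantitative form of Dirichlet's theorem: the reciprocals of the primes in an invertible
residue class have divergent sum. If the sum converged, then by dominated convergence
`s ∑ Λ(n) / n ^ (1 + s)`, over `n` in the class, would tend to `0` as `s → 0⁺`, since
`s log p ≤ p ^ s`; but that product is at least `1 / φ(q) - s C`. -/
theorem not_summable_one_div_primes_modEq {q : ℕ} [NeZero q] {a : ZMod q} (ha : IsUnit a) :
    ¬ Summable ({p : ℕ | p.Prime ∧ (p : ZMod q) = a}.indicator fun p : ℕ => 1 / (p : ℝ)) := by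
  intro hsum
  set r := ArithmeticFunction.vonMangoldt.residueClass a with hr
  have hr0 : ∀ n, 0 ≤ r n := ArithmeticFunction.vonMangoldt.residueClass_nonneg a
  have hG := hsum.add (ArithmeticFunction.vonMangoldt.summable_residueClass_non_primes_div a)
  obtain ⟨C, hC⟩ := ArithmeticFunction.vonMangoldt.LSeries_residueClass_lower_bound ha
  have hpow : ∀ (s : ℝ) (n : ℕ), 0 < n → (n : ℝ) ^ (1 + s) = n * (n : ℝ) ^ s := by
    intro s n hn
    rw [Real.rpow_add (by exact_mod_cast hn), Real.rpow_one]
  have hev : ∀ᶠ s : ℝ in 𝓝[>] 0, s ∈ Set.Ioc (0 : ℝ) 1 := Ioc_mem_nhdsGT one_pos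
  have hlim : Tendsto (fun s : ℝ => ∑' n : ℕ, s * (r n / (n : ℝ) ^ (1 + s))) (𝓝[>] 0)
      (𝓝 (∑' _ : ℕ, (0 : ℝ))) := by
    refine tendsto_tsum_of_dominated_convergence hG (fun n => ?_) ?_
    · rcases n.eq_zero_or_pos with rfl | hn
      · simp [hr]
      · have hn' : (n : ℝ) ≠ 0 := by positivity
        have : ContinuousAt (fun s : ℝ => s * (r n / (n : ℝ) ^ (1 + s))) 0 := by
          refine continuousAt_id.mul (continuousAt_const.div ?_ (by simp [hn']))
          exact ContinuousAt.rpow continuousAt_const (by fun_prop) (Or.inl hn')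
        have h0 := this.tendsto
        simp only [zero_mul] at h0
        exact h0.mono_left nhdsWithin_le_nhds
    · filter_upwards [hev] with s hs n
      have hs0 := hs.1
      rcases n.eq_zero_or_pos with rfl | hn
      · simp only [hr, ArithmeticFunction.vonMangoldt.residueClass_apply_zero, zero_div, mul_zero,
          norm_zero, ite_self, add_zero]
        exact Set.indicator_nonneg (fun _ _ => by positivity) _
      have hn1 : (1 : ℝ) ≤ n := by exact_mod_cast hn
      have hns : (1 : ℝ) ≤ (n : ℝ) ^ s := Real.one_le_rpow hn1 hs0.le
      have hnn : (0 : ℝ) < (n : ℝ) := by positivity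
      rw [Real.norm_of_nonneg (by have := hr0 n; positivity), hpow s n hn]
      by_cases hp : n.Prime
      · by_cases hpa : (n : ZMod q) = a
        · have hrn : r n = Real.log n := by
            rw [hr, ArithmeticFunction.vonMangoldt.residueClass,
              Set.indicator_of_mem (by exact hpa),
              ArithmeticFunction.vonMangoldt_apply_prime hp]
          rw [Set.indicator_of_mem (by exact ⟨hp, hpa⟩), hrn, if_pos hp, zero_div, add_zero]
          have hlog : s * Real.log n ≤ (n : ℝ) ^ s := by
            rw [← Real.log_rpow hnn]
            exact (Real.log_le_sub_one_of_pos (by positivity)).trans (by linarith)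
          rw [← mul_div_assoc, div_le_div_iff₀ (by positivity) hnn]
          nlinarith
        · have hrn : r n = 0 := by
            rw [hr, ArithmeticFunction.vonMangoldt.residueClass]
            exact Set.indicator_of_notMem (by exact hpa) _
          rw [hrn, zero_div, mul_zero, if_pos hp, zero_div, add_zero]
          exact Set.indicator_nonneg (fun _ _ => by positivity) _
      · rw [Set.indicator_of_notMem (by exact fun h => hp h.1), if_neg hp, zero_add,
          ← mul_div_assoc]
        have := hr0 n
        refine div_le_div₀ this ?_ hnn ?_
        · exact mul_le_of_le_one_left this hs.2
        · exact le_mul_of_one_le_right hnn.le hns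
  rw [tsum_zero] at hlim
  have hlow : Tendsto (fun s : ℝ => (q.totient : ℝ)⁻¹ - s * C) (𝓝[>] 0)
      (𝓝 ((q.totient : ℝ)⁻¹ - 0 * C)) :=
    Tendsto.mono_left (Continuous.tendsto (by fun_prop) 0) nhdsWithin_le_nhds
  have hle := le_of_tendsto_of_tendsto hlow hlim <| by
    filter_upwards [hev] with s hs
    have h := hC (x := 1 + s) ⟨by linarith [hs.1], by linarith [hs.2]⟩
    rw [tsum_mul_left]
    have h2 := mul_le_mul_of_nonneg_left h hs.1.le
    have hs0 := hs.1.ne'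
    rw [add_sub_cancel_left, mul_sub, mul_div_cancel₀ _ hs0] at h2
    exact h2
  have : 0 < (q.totient : ℝ)⁻¹ := inv_pos.mpr (mod_cast q.totient.pos_of_neZero)
  linarith

/-! ### Counting in periodic sets -/

theorem Nat.count_mul_of_periodic {P : ℕ → Prop} [DecidablePred P] {M : ℕ}
    (hP : Function.Periodic P M) (k : ℕ) : Nat.count P (M * k) = k * Nat.count P M := by
  induction k with
  | zero => simp
  | succ k ih =>
    have h : (fun j => P (M * k + j)) = P := by
      funext j
      rw [add_comm, mul_comm]
      exact hP.nat_mul k j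
    simp only [Nat.mul_succ, Nat.count_add, ih, h]
    ring

theorem card_Ioc_le_of_periodic {P : ℕ → Prop} [DecidablePred P] {M : ℕ} (hM : 0 < M)
    (hP : Function.Periodic P M) (N : ℕ) :
    (((Finset.Ioc 0 N).filter P).card : ℝ) ≤ Nat.count P M / M * N + M := by
  have h1 : ((Finset.Ioc 0 N).filter P).card ≤ Nat.count P (M * (N / M + 1)) := by
    rw [Nat.count_eq_card_filter_range]
    refine Finset.card_le_card (Finset.filter_subset_filter _ fun n hn => ?_)
    rw [Finset.mem_Ioc] at hn
    exact Finset.mem_range.2 (hn.2.trans_lt (Nat.lt_mul_div_succ N hM))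
  rw [Nat.count_mul_of_periodic hP] at h1
  have h2 : ((N / M : ℕ) : ℝ) ≤ N / M := Nat.cast_div_le
  have h3 : (Nat.count P M : ℝ) ≤ M := Nat.cast_le.2 (Nat.count_le _)
  have h1' : (((Finset.Ioc 0 N).filter P).card : ℝ) ≤ ((N / M : ℕ) + 1) * Nat.count P M := by
    exact_mod_cast h1
  calc _ ≤ _ := h1'
    _ ≤ ((N : ℝ) / M + 1) * Nat.count P M := by gcongr
    _ = Nat.count P M / M * N + Nat.count P M := by ring
    _ ≤ _ := by linarith

/-- Let `P` be a property of period `M` and `S` a set of divisors of `M` such that `n p` determines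
`p ∈ S` among the pairs with `P n` and `p ∤ n`. Then the density of `P` is
at most `(1 + ∑_{p ∈ S} 1/p²) / ∑_{p ∈ S} 1/p`. All counts are taken below
multiples of `M`, which makes them exact. -/
theorem count_mul_sum_one_div_le {P : ℕ → Prop} [DecidablePred P] {M : ℕ} {S : Finset ℕ}
    (hP : Function.Periodic P M) (hS0 : ∀ p ∈ S, 0 < p) (hSM : ∀ p ∈ S, p ∣ M)
    (hsep : ∀ p ∈ S, ∀ q ∈ S, ∀ m n, P m → P n → ¬ p ∣ m → ¬ q ∣ n → m * p = n * q → p = q) :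
    (Nat.count P M : ℝ) * ∑ p ∈ S, 1 / (p : ℝ) ≤ M * (1 + ∑ p ∈ S, 1 / (p : ℝ) ^ 2) := by
  rcases M.eq_zero_or_pos with rfl | hM
  · simp
  -- For each `p`, the `n < M (M / p)` with `P n` are those prime to `p`, for which the products
  -- `n p < M ^ 2` are distinct, and the multiples of `p`, of which there are at most `(M / p) ^ 2`.
  have hsplit : ∀ p ∈ S, M / p * Nat.count P M ≤
      ((Finset.range (M * (M / p))).filter fun n => P n ∧ ¬ p ∣ n).card + (M / p) ^ 2 := by
    intro p hp
    have hpM := Nat.mul_div_cancel' (hSM p hp)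
    rw [← Nat.count_mul_of_periodic hP, Nat.count_eq_card_filter_range,
      ← Finset.card_filter_add_card_filter_not (s := (Finset.range (M * (M / p))).filter P)
        (fun n => ¬ p ∣ n), Finset.filter_filter]
    refine Nat.add_le_add_left ?_ _
    rw [← Finset.card_range ((M / p) ^ 2)]
    refine Finset.card_le_card_of_injOn (· / p) (fun n hn => ?_) fun m hm n hn hmn => ?_
    · simp only [Finset.coe_filter, Finset.mem_filter, Finset.mem_range, not_not,
        Set.mem_ofPred_eq] at hn
      simp only [Finset.coe_range, Set.mem_Iio]
      refine Nat.div_lt_of_lt_mul (hn.1.1.trans_le (le_of_eq ?_))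
      rw [sq, ← mul_assoc, hpM]
    · simp only [Finset.coe_filter, Finset.mem_filter, Finset.mem_range, not_not,
        Set.mem_ofPred_eq] at hm hn
      exact (Nat.div_left_inj hm.2 hn.2).1 hmn
  have hgood : ∑ p ∈ S, ((Finset.range (M * (M / p))).filter fun n => P n ∧ ¬ p ∣ n).card
      ≤ M ^ 2 := by
    rw [← Finset.card_sigma, ← Finset.card_range (M ^ 2)]
    refine Finset.card_le_card_of_injOn (fun x => x.2 * x.1) ?_ ?_
    · rintro ⟨p, n⟩ hx
      simp only [Finset.coe_sigma, Set.mem_sigma_iff, Finset.mem_coe, Finset.mem_filter,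
        Finset.mem_range] at hx
      simp only [Finset.coe_range, Set.mem_Iio]
      calc n * p < M * (M / p) * p := Nat.mul_lt_mul_of_pos_right hx.2.1 (hS0 p hx.1)
        _ = M ^ 2 := by rw [mul_assoc, Nat.div_mul_cancel (hSM p hx.1), sq]
    · rintro ⟨p, m⟩ hx ⟨q, n⟩ hy hxy
      simp only [Finset.coe_sigma, Set.mem_sigma_iff, Finset.mem_coe, Finset.mem_filter,
        Finset.mem_range] at hx hy hxy
      obtain rfl := hsep p hx.1 q hy.1 m n hx.2.2.1 hy.2.2.1 hx.2.2.2 hy.2.2.2 hxy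
      obtain rfl := Nat.eq_of_mul_eq_mul_right (hS0 p hx.1) hxy
      rfl
  have htot : ∑ p ∈ S, M / p * Nat.count P M ≤ M ^ 2 + ∑ p ∈ S, (M / p) ^ 2 :=
    (Finset.sum_le_sum hsplit).trans (by rw [Finset.sum_add_distrib]; gcongr)
  have hcast : (∑ p ∈ S, ((M / p : ℕ) : ℝ) * Nat.count P M) ≤
      (M : ℝ) ^ 2 + ∑ p ∈ S, ((M / p : ℕ) : ℝ) ^ 2 := by exact_mod_cast htot
  have hdiv : ∀ p ∈ S, ((M / p : ℕ) : ℝ) = M * (1 / p) := fun p hp => by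
    rw [Nat.cast_div (hSM p hp) (by exact_mod_cast (hS0 p hp).ne')]
    ring
  have hM' : (0 : ℝ) < M := by exact_mod_cast hM
  refine le_of_mul_le_mul_left ?_ hM'
  calc (M : ℝ) * (Nat.count P M * ∑ p ∈ S, 1 / (p : ℝ))
      = ∑ p ∈ S, ((M / p : ℕ) : ℝ) * Nat.count P M := by
        rw [Finset.mul_sum, Finset.mul_sum]
        exact Finset.sum_congr rfl fun p hp => by rw [hdiv p hp]; ring
    _ ≤ _ := hcast
    _ = M * (M * (1 + ∑ p ∈ S, 1 / (p : ℝ) ^ 2)) := by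
        rw [mul_add, mul_add, Finset.mul_sum, Finset.mul_sum, mul_one, sq]
        congr 1
        exact Finset.sum_congr rfl fun p hp => by rw [hdiv p hp]; ring

/-! ### Divisibility of `ψ(n)` by a fixed modulus -/

theorem card_Ioc_coprime_le {Q : ℕ} (hQ : Q ≠ 0) (N : ℕ) :
    (((Finset.Ioc 0 N).filter Q.Coprime).card : ℝ) ≤
      Real.exp (-∑ p ∈ Q.primeFactors, 1 / (p : ℝ)) * N + Q := by
  have h := Nat.Ico_filter_coprime_le 1 N hQ
  rw [show Finset.Ico 1 (1 + N) = Finset.Ioc 0 N by ext; simp; omega] at h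
  have hQ' : (0 : ℝ) < Q := by exact_mod_cast hQ.bot_lt
  have htot : (Q.totient : ℝ) = Q * ∏ p ∈ Q.primeFactors, (1 - (p : ℝ)⁻¹) := by
    have := congrArg (Rat.cast : ℚ → ℝ) Q.totient_eq_mul_prod_factors
    push_cast at this
    exact this
  have hprod : ∏ p ∈ Q.primeFactors, (1 - (p : ℝ)⁻¹) ≤
      Real.exp (-∑ p ∈ Q.primeFactors, 1 / (p : ℝ)) := by
    rw [← Finset.sum_neg_distrib, Real.exp_sum]
    refine Finset.prod_le_prod (fun p hp => ?_) fun p _ => ?_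
    · have : (1 : ℝ) ≤ p := by exact_mod_cast (Nat.prime_of_mem_primeFactors hp).one_le
      linarith [inv_le_one_of_one_le₀ this]
    · have := Real.add_one_le_exp (-(1 / (p : ℝ)))
      rw [one_div] at this ⊢
      linarith
  have hle : (Q.totient : ℝ) ≤ Q := by exact_mod_cast Q.totient_le
  calc (((Finset.Ioc 0 N).filter Q.Coprime).card : ℝ)
      ≤ Q.totient * ((N / Q : ℕ) + 1) := by exact_mod_cast h
    _ ≤ Q.totient * ((N : ℝ) / Q + 1) := by gcongr; exact Nat.cast_div_le
    _ = (∏ p ∈ Q.primeFactors, (1 - (p : ℝ)⁻¹)) * N + Q.totient := by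
        rw [htot]; field_simp
    _ ≤ _ := by gcongr

theorem succ_dvd_dedekindPsi {p n : ℕ} (hp : p ∈ n.primeFactors) : p + 1 ∣ dedekindPsi n :=
  (Finset.dvd_prod_of_mem (fun p => p + 1) hp).mul_left _

/-- For each `M`, almost all `n` satisfy `M ∣ ψ(n)`, as almost all `n` have a prime factor
`p ≡ -1 (mod M)`. -/
theorem eventually_card_not_dvd_dedekindPsi_le {M : ℕ} (hM : 0 < M) {δ : ℝ} (hδ : 0 < δ) :
    ∀ᶠ N : ℕ in atTop,
      (((Finset.Ioc 0 N).filter fun n => ¬ M ∣ dedekindPsi n).card : ℝ) ≤ δ * N := by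
  have : NeZero M := ⟨hM.ne'⟩
  set A : Set ℕ := {p : ℕ | p.Prime ∧ (p : ZMod M) = -1}
  have hdiv := not_summable_one_div_primes_modEq (q := M) (a := -1) isUnit_one.neg
  obtain ⟨k, hk⟩ : ∃ k : ℕ, Real.log (2 / δ) <
      ∑ p ∈ Finset.range k, A.indicator (fun p : ℕ => 1 / (p : ℝ)) p := by
    by_contra! hcon
    exact hdiv (summable_of_sum_range_le
      (fun _ => Set.indicator_nonneg (fun _ _ => by positivity) _) hcon)
  classical
  set S := (Finset.range k).filter (· ∈ A)
  have hSprime : ∀ p ∈ S, p.Prime := fun p hp => (Finset.mem_filter.1 hp).2.1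
  set Q := ∏ p ∈ S, p
  have hQS : Q.primeFactors = S := Nat.primeFactors_prod hSprime
  have hQ0 : Q ≠ 0 := Finset.prod_ne_zero_iff.2 fun p hp => (hSprime p hp).ne_zero
  have hexp : Real.exp (-∑ p ∈ Q.primeFactors, 1 / (p : ℝ)) ≤ δ / 2 := by
    rw [hQS, Finset.sum_filter]
    rw [← Real.le_log_iff_exp_le (by positivity), ← inv_div, Real.log_inv]
    simp only [Set.indicator_apply] at hk
    linarith
  filter_upwards [eventually_ge_atTop ⌈Q / (δ / 2)⌉₊] with N hN
  have hN' : (Q : ℝ) ≤ δ / 2 * N := by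
    rw [mul_comm, ← div_le_iff₀ (by positivity)]
    exact Nat.ceil_le.1 hN
  have hsub : ((Finset.Ioc 0 N).filter fun n => ¬ M ∣ dedekindPsi n) ⊆
      (Finset.Ioc 0 N).filter Q.Coprime := by
    intro n hn
    rw [Finset.mem_filter, Finset.mem_Ioc] at hn ⊢
    refine ⟨hn.1, Nat.Coprime.prod_left fun p hp => ?_⟩
    refine ((hSprime p hp).coprime_iff_not_dvd).2 fun hpn => hn.2 ?_
    refine Dvd.dvd.trans ?_
      (succ_dvd_dedekindPsi (Nat.mem_primeFactors.2 ⟨hSprime p hp, hpn, hn.1.1.ne'⟩))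
    rw [← ZMod.natCast_eq_zero_iff]
    push_cast
    rw [(Finset.mem_filter.1 hp).2.2]
    ring
  calc (((Finset.Ioc 0 N).filter fun n => ¬ M ∣ dedekindPsi n).card : ℝ)
      ≤ ((Finset.Ioc 0 N).filter Q.Coprime).card := by
        exact_mod_cast Finset.card_le_card hsub
    _ ≤ _ := card_Ioc_coprime_le hQ0 N
    _ ≤ δ / 2 * N + δ / 2 * N := by gcongr
    _ = δ * N := by ring

/-! ### The contribution of large primes -/

/-- The part of `∑_{p ∣ n} 1/p` coming from the primes `p > T`. -/
noncomputable def tailSum (T n : ℕ) : ℝ := ∑ p ∈ n.primeFactors with T < p, 1 / (p : ℝ)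

theorem tailSum_nonneg (T n : ℕ) : 0 ≤ tailSum T n :=
  Finset.sum_nonneg fun _ _ => by positivity

theorem sum_tailSum_le {T : ℕ} (hT : 0 < T) (N : ℕ) :
    ∑ n ∈ Finset.Ioc 0 N, tailSum T n ≤ N / T := by
  rcases le_total N T with hNT | hTN
  · refine (Finset.sum_nonpos fun n hn => le_of_eq ?_).trans (by positivity)
    refine Finset.sum_eq_zero fun p hp => ?_
    rw [Finset.mem_Ioc] at hn
    rw [Finset.mem_filter] at hp
    have := Nat.le_of_mem_primeFactors hp.1
    omega
  calc ∑ n ∈ Finset.Ioc 0 N, tailSum T n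
      ≤ ∑ n ∈ Finset.Ioc 0 N, ∑ p ∈ Finset.Ioc T N, if p ∣ n then 1 / (p : ℝ) else 0 := by
        refine Finset.sum_le_sum fun n hn => ?_
        rw [← Finset.sum_filter]
        refine Finset.sum_le_sum_of_subset_of_nonneg (fun p hp => ?_) fun _ _ _ => by positivity
        rw [Finset.mem_Ioc] at hn
        rw [Finset.mem_filter] at hp
        rw [Finset.mem_filter, Finset.mem_Ioc]
        exact ⟨⟨hp.2, (Nat.le_of_mem_primeFactors hp.1).trans hn.2⟩,
          Nat.dvd_of_mem_primeFactors hp.1⟩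
    _ = ∑ p ∈ Finset.Ioc T N, (N / p : ℕ) * (1 / (p : ℝ)) := by
        rw [Finset.sum_comm]
        refine Finset.sum_congr rfl fun p _ => ?_
        rw [← Finset.sum_filter, Finset.sum_const, Nat.Ioc_filter_dvd_card_eq_div, nsmul_eq_mul]
    _ ≤ ∑ p ∈ Finset.Ioc T N, N * ((p : ℝ) ^ 2)⁻¹ := by
        refine Finset.sum_le_sum fun p _ => ?_
        calc ((N / p : ℕ) : ℝ) * (1 / (p : ℝ)) ≤ (N / p : ℝ) * (1 / (p : ℝ)) := by
              gcongr; exact Nat.cast_div_le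
          _ = _ := by rw [sq, mul_inv]; ring
    _ ≤ N * (T : ℝ)⁻¹ := by
        rw [← Finset.mul_sum]
        gcongr
        have := sum_Ioc_inv_sq_le_sub (α := ℝ) hT.ne' hTN
        have h2 : (0 : ℝ) ≤ (N : ℝ)⁻¹ := by positivity
        linarith
    _ = N / T := by ring

theorem card_le_tailSum_le {T : ℕ} (hT : 0 < T) {η : ℝ} (hη : 0 < η) (N : ℕ) :
    (((Finset.Ioc 0 N).filter fun n => η ≤ tailSum T n).card : ℝ) ≤ N / (T * η) := by
  rw [← div_div, le_div_iff₀ hη, ← nsmul_eq_mul]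
  refine le_trans ?_ (sum_tailSum_le hT N)
  exact (Finset.card_nsmul_le_sum _ _ _ fun n hn => (Finset.mem_filter.1 hn).2).trans
    (Finset.sum_le_sum_of_subset_of_nonneg (Finset.filter_subset _ _)
      fun n _ _ => tailSum_nonneg T n)

/-! ### The contribution of small primes -/

/-- `∏ (1 + 1/p)` over the primes `p ≤ T` dividing `n`: the part of `ψ(n)/n` carried by the primes
up to `T`. Unlike `ψ(n)/n`, it is periodic in `n`. -/
noncomputable def psiRatioUpTo (T n : ℕ) : ℝ := ∏ p ∈ T.primesLE with p ∣ n, (1 + 1 / (p : ℝ))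

theorem psiRatioUpTo_pos (T n : ℕ) : 0 < psiRatioUpTo T n :=
  Finset.prod_pos fun _ _ => by positivity

theorem psiRatioUpTo_congr {T m n : ℕ} (h : ∀ p ∈ T.primesLE, (p ∣ m ↔ p ∣ n)) :
    psiRatioUpTo T m = psiRatioUpTo T n := by
  unfold psiRatioUpTo
  rw [Finset.filter_congr h]

theorem dvd_primorial {p T : ℕ} (hp : p ∈ T.primesLE) : p ∣ primorial T :=
  Finset.dvd_prod_of_mem (fun p => p) hp

theorem psiRatioUpTo_periodic (T : ℕ) : Function.Periodic (psiRatioUpTo T) (primorial T) :=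
  fun _ => psiRatioUpTo_congr fun _ hp => (Nat.dvd_add_left (dvd_primorial hp))

theorem psiRatioUpTo_mul {T p n : ℕ} (hp : p ∈ T.primesLE) (hpn : ¬ p ∣ n) :
    psiRatioUpTo T (n * p) = psiRatioUpTo T n * (1 + 1 / (p : ℝ)) := by
  have hprime := (Nat.mem_primesLE.1 hp).2
  have h : (T.primesLE.filter (· ∣ n * p)) = insert p (T.primesLE.filter (· ∣ n)) := by
    ext q
    simp only [Finset.mem_filter, Finset.mem_insert]
    constructor
    · rintro ⟨hq, hqd⟩
      rcases (Nat.mem_primesLE.1 hq).2.dvd_mul.1 hqd with h | h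
      · exact Or.inr ⟨hq, h⟩
      · exact Or.inl ((Nat.prime_dvd_prime_iff_eq (Nat.mem_primesLE.1 hq).2 hprime).1 h)
    · rintro (rfl | ⟨hq, hqd⟩)
      · exact ⟨hp, dvd_mul_left _ _⟩
      · exact ⟨hq, hqd.mul_right _⟩
  rw [psiRatioUpTo, h, Finset.prod_insert (by simp [hpn]), mul_comm, psiRatioUpTo]

theorem dedekindPsi_div_eq {n : ℕ} (hn : 0 < n) :
    (dedekindPsi n : ℝ) / n = ∏ p ∈ n.primeFactors, (1 + 1 / (p : ℝ)) := by
  have h := congrArg (Rat.cast : ℚ → ℝ) (dedekindPsi_eq n)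
  push_cast at h
  rw [h, mul_div_cancel_left₀ _ (by exact_mod_cast hn.ne')]

theorem primesLE_filter_dvd {T n : ℕ} (hn : 0 < n) :
    T.primesLE.filter (· ∣ n) = n.primeFactors.filter (¬ T < ·) := by
  ext p
  simp only [Finset.mem_filter, Nat.mem_primesLE, Nat.mem_primeFactors, not_lt]
  have := hn.ne'
  tauto

theorem dedekindPsi_div_eq_mul {T n : ℕ} (hn : 0 < n) :
    (dedekindPsi n : ℝ) / n =
      (∏ p ∈ n.primeFactors with T < p, (1 + 1 / (p : ℝ))) * psiRatioUpTo T n := by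
  rw [dedekindPsi_div_eq hn, psiRatioUpTo, primesLE_filter_dvd hn,
    Finset.prod_filter_mul_prod_filter_not]

theorem psiRatioUpTo_le {T n : ℕ} (hn : 0 < n) : psiRatioUpTo T n ≤ (dedekindPsi n : ℝ) / n := by
  rw [dedekindPsi_div_eq_mul (T := T) hn]
  refine le_mul_of_one_le_left (psiRatioUpTo_pos T n).le ?_
  exact Finset.one_le_prod fun p _ => le_add_of_nonneg_right (by positivity)

theorem dedekindPsi_div_le {T n : ℕ} (hn : 0 < n) :
    (dedekindPsi n : ℝ) / n ≤ Real.exp (tailSum T n) * psiRatioUpTo T n := by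
  rw [dedekindPsi_div_eq_mul (T := T) hn, tailSum, Real.exp_sum]
  refine mul_le_mul_of_nonneg_right ?_ (psiRatioUpTo_pos T n).le
  refine Finset.prod_le_prod (fun _ _ => by positivity) fun p _ => ?_
  rw [add_comm]
  exact Real.add_one_le_exp _

/-! ### Non-concentration -/

theorem one_add_one_div_separated {p q K : ℕ} (hp : 0 < p) (hpq : p < q) (hq : q ≤ K) :
    (1 + 1 / (q : ℝ)) * (1 + 1 / (K * (K + 1))) ≤ 1 + 1 / (p : ℝ) := by
  have hp' : (1 : ℝ) ≤ p := by exact_mod_cast hp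
  have hpq' : (p : ℝ) + 1 ≤ q := by exact_mod_cast hpq
  have hq' : (q : ℝ) ≤ K := by exact_mod_cast hq
  -- `(1 + 1 / q) (1 + 1 / ((q - 1) (q + 1))) = 1 + 1 / (q - 1)`, and `p ≤ q - 1`.
  have h1 : 1 + 1 / ((q : ℝ) - 1) ≤ 1 + 1 / (p : ℝ) := by
    gcongr
    linarith
  refine le_trans ?_ h1
  have h2 : 1 / ((K : ℝ) * (K + 1)) ≤ 1 / ((q - 1) * (q + 1)) := by
    have : (0 : ℝ) < q - 1 := by linarith
    gcongr
    linarith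
  calc (1 + 1 / (q : ℝ)) * (1 + 1 / (K * (K + 1)))
      ≤ (1 + 1 / (q : ℝ)) * (1 + 1 / ((q - 1) * (q + 1))) := by gcongr
    _ = 1 + 1 / ((q : ℝ) - 1) := by
        have : (q : ℝ) - 1 ≠ 0 := by linarith
        have : (q : ℝ) + 1 ≠ 0 := by linarith
        have : (q : ℝ) ≠ 0 := by linarith
        field_simp
        ring

/-- The density of the `n` with `l ≤ h_T(n) ≤ u` is at most `2 / ∑_{p ≤ K} 1/p` when `u / l` is so
close to `1` that multiplying `n` by different primes up to `K` cannot give the same value. -/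
theorem count_psiRatioUpTo_mul_sum_le {K T : ℕ} (hKT : K ≤ T) {l u : ℝ}
    (hu : u < l * (1 + 1 / (K * (K + 1))))
    [DecidablePred fun n => l ≤ psiRatioUpTo T n ∧ psiRatioUpTo T n ≤ u] :
    (Nat.count (fun n => l ≤ psiRatioUpTo T n ∧ psiRatioUpTo T n ≤ u) (primorial T) : ℝ) *
      ∑ p ∈ K.primesLE, 1 / (p : ℝ) ≤ primorial T * 2 := by
  have hmem : ∀ {p}, p ∈ K.primesLE → p ∈ T.primesLE := fun hp =>
    Nat.mem_primesLE.2 ⟨(Nat.mem_primesLE.1 hp).1.trans hKT, (Nat.mem_primesLE.1 hp).2⟩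
  have key : ∀ p ∈ K.primesLE, ∀ q ∈ K.primesLE, ∀ m n, l ≤ psiRatioUpTo T m →
      psiRatioUpTo T n ≤ u → ¬ p ∣ m → ¬ q ∣ n → m * p = n * q → ¬ p < q := by
    intro p hp q hq m n hm hn hpm hqn h hpq
    have h' := congrArg (psiRatioUpTo T) h
    rw [psiRatioUpTo_mul (hmem hp) hpm, psiRatioUpTo_mul (hmem hq) hqn] at h'
    have hsep := one_add_one_div_separated (Nat.mem_primesLE.1 hp).2.pos hpq
      (Nat.mem_primesLE.1 hq).1
    have hq0 : (0 : ℝ) < 1 + 1 / (q : ℝ) := by positivity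
    have h1 : l * ((1 + 1 / (q : ℝ)) * (1 + 1 / (K * (K + 1)))) ≤ u * (1 + 1 / (q : ℝ)) :=
      calc _ ≤ psiRatioUpTo T m * (1 + 1 / (p : ℝ)) := by
            have := (psiRatioUpTo_pos T m).le
            gcongr
        _ = psiRatioUpTo T n * (1 + 1 / (q : ℝ)) := h'
        _ ≤ _ := by gcongr
    have h2 : (1 + 1 / (q : ℝ)) * u < (1 + 1 / (q : ℝ)) * (l * (1 + 1 / (K * (K + 1)))) :=
      mul_lt_mul_of_pos_left hu hq0
    linarith
  refine (count_mul_sum_one_div_le (fun n => ?_) (fun p hp => (Nat.mem_primesLE.1 hp).2.pos)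
    (fun p hp => dvd_primorial (hmem hp)) ?_).trans ?_
  · simp only [psiRatioUpTo_periodic T n]
  · intro p hp q hq m n hm hn hpm hqn h
    exact le_antisymm (not_lt.1 (key q hq p hp n m hn.1 hm.2 hqn hpm h.symm))
      (not_lt.1 (key p hp q hq m n hm.1 hn.2 hpm hqn h))
  · have hsq : ∑ p ∈ K.primesLE, 1 / (p : ℝ) ^ 2 ≤ 1 := by
      rcases K.eq_zero_or_pos with rfl | hK
      · rw [Finset.sum_eq_zero]
        · exact zero_le_one
        · intro p hp
          have := Nat.mem_primesLE.1 hp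
          exact absurd this.2.pos (by omega)
      calc ∑ p ∈ K.primesLE, 1 / (p : ℝ) ^ 2 ≤ ∑ p ∈ Finset.Ioc 1 K, ((p : ℝ) ^ 2)⁻¹ := by
            simp only [one_div]
            refine Finset.sum_le_sum_of_subset_of_nonneg (fun p hp => ?_)
              fun _ _ _ => by positivity
            have := Nat.mem_primesLE.1 hp
            exact Finset.mem_Ioc.2 ⟨this.2.one_lt, this.1⟩
        _ ≤ 1 := by
            have := sum_Ioc_inv_sq_le_sub (α := ℝ) one_ne_zero hK
            have h2 : (0 : ℝ) ≤ (K : ℝ)⁻¹ := by positivity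
            simp only [Nat.cast_one, inv_one] at this
            linarith
    gcongr
    linarith

theorem exists_lt_sum_one_div_primesLE (R : ℝ) :
    ∃ K : ℕ, R < ∑ p ∈ K.primesLE, 1 / (p : ℝ) := by
  by_contra! hcon
  refine not_summable_one_div_on_primes (summable_of_sum_range_le (c := R)
      (fun _ => Set.indicator_nonneg (fun _ _ => by positivity) _) fun n => ?_)
  refine le_trans ?_ (hcon n)
  simp only [Set.indicator_apply]
  rw [← Finset.sum_filter]
  refine Finset.sum_le_sum_of_subset_of_nonneg (fun p hp => ?_) fun _ _ _ => by positivity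
  rw [Finset.mem_filter, Finset.mem_range] at hp
  exact Nat.mem_primesLE.2 ⟨hp.1.le, hp.2⟩

/-! ### Density of amicable numbers -/

theorem PsiAmicable.psiRatioUpTo_mem {a b T : ℕ} {η : ℝ} (h : PsiAmicable a b) (hab : a ≤ b)
    (hdvd : primorial T ∣ dedekindPsi a) (htail : tailSum T a < η) :
    2 * Real.exp (-η) ≤ psiRatioUpTo T a ∧ psiRatioUpTo T a ≤ 2 := by
  obtain ⟨ha, hb, hpa, hpb⟩ := h
  have ha' : (0 : ℝ) < a := by exact_mod_cast ha
  have hb' : (0 : ℝ) < b := by exact_mod_cast hb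
  have hab' : (a : ℝ) ≤ b := by exact_mod_cast hab
  constructor
  · have h1 : 2 ≤ (dedekindPsi a : ℝ) / a := by
      rw [le_div_iff₀ ha', hpa]
      push_cast
      linarith
    have h2 := h1.trans (dedekindPsi_div_le (T := T) ha)
    have h3 : Real.exp (tailSum T a) * psiRatioUpTo T a ≤ Real.exp η * psiRatioUpTo T a :=
      mul_le_mul_of_nonneg_right (Real.exp_le_exp.2 htail.le) (psiRatioUpTo_pos T a).le
    rw [Real.exp_neg, ← div_eq_mul_inv, div_le_iff₀ (Real.exp_pos η)]
    linarith
  · have hcongr : psiRatioUpTo T a = psiRatioUpTo T b := by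
      refine psiRatioUpTo_congr fun p hp => ?_
      have : p ∣ a + b := hpa ▸ (dvd_primorial hp).trans hdvd
      exact ⟨fun h => (Nat.dvd_add_right h).1 this, fun h => (Nat.dvd_add_left h).1 this⟩
    rw [hcongr]
    refine (psiRatioUpTo_le hb).trans ?_
    rw [div_le_iff₀ hb', hpb]
    push_cast
    linarith

open Classical in
/-- The smaller members of `ψ`-amicable pairs, including `a = b`, have density zero. -/
theorem eventually_card_smaller_le {δ : ℝ} (hδ : 0 < δ) :
    ∀ᶠ N : ℕ in atTop,
      (((Finset.Ioc 0 N).filter fun a => ∃ b, a ≤ b ∧ PsiAmicable a b).card : ℝ) ≤ δ * N := by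
  -- `K` makes the density bound `2 / ∑_{p ≤ K} 1/p` at most `δ / 4`. Each of the three other error
  -- terms (the tail, the divisibility and the period) also gets `δ / 4`.
  obtain ⟨K, hK⟩ := exists_lt_sum_one_div_primesLE (8 / δ)
  have hK0 : 0 < K := by
    rcases K.eq_zero_or_pos with rfl | h
    · have : (0 : ℕ).primesLE = ∅ := by
        ext p
        simp only [Nat.mem_primesLE, Finset.notMem_empty, iff_false, not_and]
        intro h hp
        exact hp.ne_zero (Nat.le_zero.1 h)
      rw [this, Finset.sum_empty] at hK
      exact absurd hK (not_lt.2 (by positivity))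
    · exact h
  set c : ℝ := 1 / (K * (K + 1)) with hc
  have hc0 : 0 < c := by positivity
  obtain ⟨η, hη0, hη⟩ : ∃ η : ℝ, 0 < η ∧ Real.exp η < 1 + c := by
    have hlog := Real.log_pos (show 1 < 1 + c by linarith)
    refine ⟨Real.log (1 + c) / 2, by positivity, ?_⟩
    rw [← Real.lt_log_iff_exp_lt (by positivity)]
    linarith
  set T := max K ⌈4 / (δ * η)⌉₊
  have hKT : K ≤ T := le_max_left _ _
  have hT0 : 0 < T := hK0.trans_le hKT
  have hT : 4 / (δ * η) ≤ T := Nat.ceil_le.1 (le_max_right _ _)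
  set M := primorial T
  have hM : 0 < M := primorial_pos T
  have hM' : (0 : ℝ) < M := by exact_mod_cast hM
  set P : ℕ → Prop := fun n => 2 * Real.exp (-η) ≤ psiRatioUpTo T n ∧ psiRatioUpTo T n ≤ 2
    with hP
  have hdens : (Nat.count P M : ℝ) / M ≤ δ / 4 := by
    have h := count_psiRatioUpTo_mul_sum_le hKT (l := 2 * Real.exp (-η)) (u := 2)
      (by
        rw [Real.exp_neg, ← hc, mul_assoc]
        have : 1 < (Real.exp η)⁻¹ * (1 + c) := by
          rwa [inv_mul_eq_div, one_lt_div (Real.exp_pos η)]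
        linarith)
    have h2 : (Nat.count P M : ℝ) * (8 / δ) ≤ M * 2 :=
      (mul_le_mul_of_nonneg_left hK.le (Nat.cast_nonneg _)).trans h
    rw [div_le_iff₀ hM']
    rw [← mul_div_assoc, div_le_iff₀ hδ] at h2
    linarith
  filter_upwards [eventually_card_not_dvd_dedekindPsi_le hM (show 0 < δ / 4 by positivity),
    eventually_ge_atTop ⌈M / (δ / 4)⌉₊] with N hN1 hN2
  have hMN : (M : ℝ) ≤ δ / 4 * N := by
    rw [mul_comm, ← div_le_iff₀ (by positivity)]
    exact Nat.ceil_le.1 hN2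
  have htail : (((Finset.Ioc 0 N).filter fun n => η ≤ tailSum T n).card : ℝ) ≤ δ / 4 * N := by
    refine (card_le_tailSum_le hT0 hη0 N).trans ?_
    have hT' : (0 : ℝ) < T := by exact_mod_cast hT0
    rw [div_le_iff₀ (by positivity)] at hT ⊢
    have := mul_le_mul_of_nonneg_left hT (Nat.cast_nonneg (α := ℝ) N)
    linarith
  have hper : Function.Periodic P M := fun n => by
    simp only [hP, psiRatioUpTo_periodic T n, M]
  have hE := card_Ioc_le_of_periodic hM hper N
  have hsub : ((Finset.Ioc 0 N).filter fun a => ∃ b, a ≤ b ∧ PsiAmicable a b) ⊆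
      ((Finset.Ioc 0 N).filter fun n => ¬ M ∣ dedekindPsi n) ∪
        (((Finset.Ioc 0 N).filter fun n => η ≤ tailSum T n) ∪ (Finset.Ioc 0 N).filter P) := by
    intro a ha
    simp only [Finset.mem_union, Finset.mem_filter] at ha ⊢
    obtain ⟨haN, b, hab, h⟩ := ha
    by_cases h1 : M ∣ dedekindPsi a
    · by_cases h2 : η ≤ tailSum T a
      · exact Or.inr (Or.inl ⟨haN, h2⟩)
      · exact Or.inr (Or.inr ⟨haN, h.psiRatioUpTo_mem hab h1 (not_le.1 h2)⟩)
    · exact Or.inl ⟨haN, h1⟩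
  have hcard := (Finset.card_le_card hsub).trans ((Finset.card_union_le _ _).trans
    (Nat.add_le_add_left (Finset.card_union_le _ _) _))
  have hcard' : (((Finset.Ioc 0 N).filter fun a => ∃ b, a ≤ b ∧ PsiAmicable a b).card : ℝ) ≤
      ((Finset.Ioc 0 N).filter fun n => ¬ M ∣ dedekindPsi n).card +
        (((Finset.Ioc 0 N).filter fun n => η ≤ tailSum T n).card +
          ((Finset.Ioc 0 N).filter P).card) := by exact_mod_cast hcard
  have := mul_le_mul_of_nonneg_right hdens (Nat.cast_nonneg (α := ℝ) N)
  linarith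

open Classical in
theorem psiAmicableCount_le (n : ℕ) :
    psiAmicableCount n ≤
      ((Finset.Ioc 0 n).filter fun a => ∃ b, a ≤ b ∧ PsiAmicable a b).card := by
  rw [psiAmicableCount, ← Set.ncard_coe_finset]
  refine Set.ncard_le_ncard_of_injOn Prod.fst ?_ ?_ (Finset.finite_toSet _)
  · rintro ⟨a, b⟩ ⟨h, hab, hn⟩
    rw [Finset.mem_coe, Finset.mem_filter, Finset.mem_Ioc]
    exact ⟨⟨h.1, hn⟩, b, hab.le, h⟩
  · rintro ⟨a, b⟩ ⟨h, -, -⟩ ⟨a', b'⟩ ⟨h', -, -⟩ haa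
    simp only at haa
    subst haa
    have := h.2.2.1.symm.trans h'.2.2.1
    simp only at this
    rw [Nat.add_left_cancel this]

open Classical in
theorem ncard_isPsiAmicableNumber_le (n : ℕ) :
    {m : ℕ | m ≤ n ∧ IsPsiAmicableNumber m}.ncard ≤
      2 * ((Finset.Ioc 0 n).filter fun a => ∃ b, a ≤ b ∧ PsiAmicable a b).card := by
  set A := (Finset.Ioc 0 n).filter fun a => ∃ b, a ≤ b ∧ PsiAmicable a b
  have hsub : {m : ℕ | m ≤ n ∧ IsPsiAmicableNumber m} ⊆
      ((A ∪ A.image fun a => dedekindPsi a - a : Finset ℕ) : Set ℕ) := by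
    rintro m ⟨hm, b, h⟩
    rw [Finset.mem_coe, Finset.mem_union, Finset.mem_image]
    have hA : ∀ {a b}, a ≤ n → a ≤ b → PsiAmicable a b → a ∈ A := fun ha hab h =>
      Finset.mem_filter.2 ⟨Finset.mem_Ioc.2 ⟨h.1, ha⟩, _, hab, h⟩
    rcases le_total m b with hmb | hbm
    · exact Or.inl (hA hm hmb h)
    · have h' : PsiAmicable b m := ⟨h.2.1, h.1, add_comm m b ▸ h.2.2.2, add_comm m b ▸ h.2.2.1⟩
      exact Or.inr ⟨b, hA (hbm.trans hm) hbm h', by rw [h'.2.2.1, Nat.add_sub_cancel_left]⟩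
  calc _ ≤ _ := Set.ncard_le_ncard hsub (Finset.finite_toSet _)
    _ = _ := Set.ncard_coe_finset _
    _ ≤ A.card + (A.image fun a => dedekindPsi a - a).card := Finset.card_union_le _ _
    _ ≤ A.card + A.card := Nat.add_le_add_left Finset.card_image_le _
    _ = 2 * A.card := by ring

theorem theorem1 :
    ((fun n : ℕ => (psiAmicableCount n : ℝ)) =o[atTop] fun n : ℕ => (n : ℝ)) ∧
    Tendsto (fun n : ℕ => (({m : ℕ | m ≤ n ∧ IsPsiAmicableNumber m}.ncard : ℕ) : ℝ) / (n : ℝ))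
      atTop (𝓝 0) := by
  classical
  constructor
  · refine isLittleO_iff.2 fun δ hδ => ?_
    filter_upwards [eventually_card_smaller_le hδ] with n hn
    rw [Real.norm_natCast, Real.norm_natCast]
    exact le_trans (by exact_mod_cast psiAmicableCount_le n) hn
  · have hlo : (fun n : ℕ => (({m : ℕ | m ≤ n ∧ IsPsiAmicableNumber m}.ncard : ℕ) : ℝ)) =o[atTop]
        fun n : ℕ => (n : ℝ) := by
      refine isLittleO_iff.2 fun δ hδ => ?_
      filter_upwards [eventually_card_smaller_le (half_pos hδ)] with n hn
      rw [Real.norm_natCast, Real.norm_natCast]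
      have h : (({m : ℕ | m ≤ n ∧ IsPsiAmicableNumber m}.ncard : ℕ) : ℝ) ≤
          2 * ((Finset.Ioc 0 n).filter fun a => ∃ b, a ≤ b ∧ PsiAmicable a b).card := by
        exact_mod_cast ncard_isPsiAmicableNumber_le n
      linarith
    exact hlo.tendsto_div_nhds_zero
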